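/- Let $d\in\{1,2,3\}$ and $s\in\mathbb{N}$. Let $D\subset\mathbb{R}^d$ be a (nonempty, open) bounded convex domain which has a $C^2$ boundary if $d\ge 2$ or, for $d=2$, is a strictly convex polygon. Let $V=H^1_0(D)$ with norm $\|v\|_V=\|\nabla v\|_{L^2(D)}$ and let $V^*$ be its dual. Let $a_1,\dots,a_s\in W^{1,\infty}(D)$ and $\bar\ell,\ell_0,\dots,\ell_s\in V^*$, where moreover $\ell_0\in L^\infty(D)$ with $\inf_{x\in D}\ell_0(x)>0$. For $y=(w,z)\in\mathbb{R}^{2s+1}$ with $w=(w_0,\dots,w_s)=(y_0,\dots,y_s)$ and $z=(z_1,\dots,z_s)=(y_{s+1},\dots,y_{2s})$ put $$a(x,z)=\exp\Big(\sum_{j=1}^s z_j a_j(x)\Big),\qquad \ell(\cdot,w)=\bar\ell+\sum_{i=0}^s w_i\ell_i ,$$ and $a_{\min}(z)=\operatorname{ess\,inf}_{x\in D}a(x,z)$, $b_j=\|a_j\|_{L^\infty(D)}$, $\bar c=\|\bar\ell\|_{V^*}$, $c_i=\|\ell_i\|_{V^*}$. Then for every $y=(w,z)\in\mathbb{R}^{2s+1}$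 there is a unique $u(\cdot,y)\in V$ with $$\int_D a(x,z)\,\nabla u(x,y)\cdot\nabla v(x)\,dx=\langle \ell(\cdot,w),v\rangle\qquad\text{for all } v\in V,$$ the map $y\mapsto u(\cdot,y)\in V$ is infinitely differentiable, and for every multi-index $\nu=(\nu_w,\nu_z)\in\mathbb{N}_0^{2s+1}$, $\nu_w=(\nu_0,\dots,\nu_s)$, $\nu_z=(\nu_{s+1},\dots,\nu_{2s})$, and every $y=(w,z)\in\mathbb{R}^{2s+1}$, the mixed derivative $\partial^\nu u(\cdot,y)=\big(\prod_{i=0}^{2s}\partial_{y_i}^{\nu_i}\big)u(\cdot,y)$ satisfies $$\|\partial^\nu u(\cdot,y)\|_V\le\begin{cases}\dfrac{|\nu_z|!}{(\ln 2)^{|\nu_z|}}\Big(\displaystyle\prod_{j=1}^s b_j^{\nu_{s+j}}\Big)\dfrac{\bar c+\sum_{i=0}^s c_i|w_i|}{a_{\min}(z)} & \text{if }\nu_w=0,\\[2ex] \dfrac{|\nu_z|!}{(\ln 2)^{|\nu_z|}}\Big(\displaystyle\prod_{j=1}^s b_j^{\nu_{s+j}}\Big)\dfrac{c_k}{a_{\min}(z)}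 & \text{if }\nu_w=e_k,\ k\in\{0,\dots,s\},\\[2ex] 0 & \text{otherwise, i.e. if } |\nu_w|\ge 2.\end{cases}$$ Here $|\cdot|$ of a multi-index is the sum of its entries and $0^0=1$. -/

import Mathlib

open MeasureTheory TopologicalSpace
open scoped ENNReal ContDiff Distributions InnerProductSpace

noncomputable section

namespace LognormalPDE

/-- The Euclidean space `ℝᵈ`. -/
abbrev Space (d : ℕ) : Type := EuclideanSpace ℝ (Fin d)

/-! ### The physical domain -/

/-- `D` has a `C²` boundary: near each of its boundary points, `D` is the strict sublevel set
`{ρ < 0}` of a `C²` function `ρ` that vanishes at the point and whose differential does not. -/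
def HasC2Boundary {d : ℕ} (D : Set (Space d)) : Prop :=
  ∀ x ∈ frontier D, ∃ U : Set (Space d), IsOpen U ∧ x ∈ U ∧ ∃ ρ : Space d → ℝ,
    ContDiffOn ℝ 2 ρ U ∧ ρ x = 0 ∧ fderiv ℝ ρ x ≠ 0 ∧ D ∩ U = {y ∈ U | ρ y < 0}

/-- `D` is the interior of the convex hull of finitely many points. In the plane and for nonempty
`D` these are the (open) strictly convex polygons: all angles at the vertices, that is, at the
extreme points of the hull, are less than `π`. -/
def IsOpenConvexPolytope {d : ℕ} (D : Set (Space d)) : Prop :=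
  ∃ P : Finset (Space d), D = interior (convexHull ℝ (P : Set (Space d)))

/-- The physical domains: bounded convex domains in `ℝᵈ`, `d ∈ {1, 2, 3}`, with a `C²` boundary
if `d ≥ 2`, or, for `d = 2`, strictly convex polygons. -/
structure Domain (d : ℕ) where
  /-- the underlying open set -/
  carrier : Opens (Space d)
  dim : d = 1 ∨ d = 2 ∨ d = 3
  nonempty : (carrier : Set (Space d)).Nonempty
  bounded : Bornology.IsBounded (carrier : Set (Space d))
  convex : Convex ℝ (carrier : Set (Space d))
  boundary : 2 ≤ d → HasC2Boundary (carrier : Set (Space d)) ∨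
    (d = 2 ∧ IsOpenConvexPolytope (carrier : Set (Space d)))

variable {d : ℕ}

/-- Lebesgue measure on the open set `Ω`. -/
abbrev vol (Ω : Opens (Space d)) : Measure (Space d) := volume.restrict (Ω : Set (Space d))

/-! ### Weak gradients and `W^{1,∞}` -/

/-- The vector field `g` is the weak gradient of `f` on `Ω`: `∫_Ω f ∇φ = - ∫_Ω φ g` for all
`φ ∈ C_c^∞(Ω)`. (Used for functions `f` and fields `g` that are integrable on `Ω`.) -/
def HasWeakGradient (Ω : Opens (Space d)) (f : Space d → ℝ) (g : Space d → Space d) : Prop :=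
  ∀ φ : 𝓓(Ω, ℝ), ∫ x in Ω, f x • gradient φ x = - ∫ x in Ω, φ x • g x

/-- `f ∈ W^{1,∞}(Ω)`: `f` and its weak gradient are in `L^∞(Ω)`. -/
def MemW1Infty (Ω : Opens (Space d)) (f : Space d → ℝ) : Prop :=
  MemLp f ∞ (vol Ω) ∧ ∃ g : Space d → Space d, MemLp g ∞ (vol Ω) ∧ HasWeakGradient Ω f g

/-! ### The space `V = H¹₀(D)` -/

/-- `L²(Ω)`. -/
abbrev L2 (Ω : Opens (Space d)) : Type := Lp ℝ 2 (vol Ω)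

/-- `L²(Ω; ℝᵈ)`. -/
abbrev L2Vec (Ω : Opens (Space d)) : Type := Lp (Space d) 2 (vol Ω)

theorem continuous_gradient {Ω : Opens (Space d)} (φ : 𝓓(Ω, ℝ)) : Continuous (gradient φ) :=
  (InnerProductSpace.toDual ℝ (Space d)).symm.continuous.comp
    (φ.contDiff.continuous_fderiv (by simp))

theorem hasCompactSupport_gradient {Ω : Opens (Space d)} (φ : 𝓓(Ω, ℝ)) :
    HasCompactSupport (gradient φ) :=
  (φ.hasCompactSupport.fderiv (𝕜 := ℝ)).comp_left (map_zero _)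

theorem memLp_test {Ω : Opens (Space d)} (φ : 𝓓(Ω, ℝ)) : MemLp φ 2 (vol Ω) :=
  φ.continuous.memLp_of_hasCompactSupport φ.hasCompactSupport

theorem memLp_gradient {Ω : Opens (Space d)} (φ : 𝓓(Ω, ℝ)) : MemLp (gradient φ) 2 (vol Ω) :=
  (continuous_gradient φ).memLp_of_hasCompactSupport (hasCompactSupport_gradient φ)

theorem differentiable_test {Ω : Opens (Space d)} (φ : 𝓓(Ω, ℝ)) : Differentiable ℝ φ :=
  φ.contDiff.differentiable (by simp)

theorem gradient_test_add {Ω : Opens (Space d)} (φ ψ : 𝓓(Ω, ℝ)) :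
    gradient (φ + ψ : 𝓓(Ω, ℝ)) = gradient φ + gradient ψ := by
  ext1 x
  have h : fderiv ℝ (φ + ψ : 𝓓(Ω, ℝ)) x = fderiv ℝ φ x + fderiv ℝ ψ x :=
    fderiv_add (differentiable_test φ x) (differentiable_test ψ x)
  simp only [gradient, h, map_add, Pi.add_apply]

theorem gradient_test_smul {Ω : Opens (Space d)} (c : ℝ) (φ : 𝓓(Ω, ℝ)) :
    gradient (c • φ : 𝓓(Ω, ℝ)) = c • gradient φ := by
  ext1 x
  have h : fderiv ℝ (c • φ : 𝓓(Ω, ℝ)) x = c • fderiv ℝ φ x :=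
    fderiv_const_smul (differentiable_test φ x) c
  rw [gradient, h]
  simp [gradient]

/-- A test function `φ ∈ C_c^∞(Ω)` as the pair `(φ, ∇φ)` in `L²(Ω) × L²(Ω; ℝᵈ)`. -/
def testPair (Ω : Opens (Space d)) : 𝓓(Ω, ℝ) →ₗ[ℝ] L2 Ω × L2Vec Ω where
  toFun φ := ((memLp_test φ).toLp φ, (memLp_gradient φ).toLp (gradient φ))
  map_add' φ ψ := by
    refine Prod.ext ?_ ?_
    · exact MemLp.toLp_add (memLp_test φ) (memLp_test ψ)
    · change _ = MemLp.toLp _ (memLp_gradient φ) + MemLp.toLp _ (memLp_gradient ψ)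
      rw [← MemLp.toLp_add]
      simp only [gradient_test_add]
  map_smul' c φ := by
    refine Prod.ext ?_ ?_
    · exact MemLp.toLp_const_smul c (memLp_test φ)
    · change _ = c • MemLp.toLp _ (memLp_gradient φ)
      rw [← MemLp.toLp_const_smul]
      simp only [gradient_test_smul]

/-- `H¹₀(Ω)`, the closure of `C_c^∞(Ω)` in `H¹(Ω)`. A function `v ∈ H¹₀(Ω)` is represented by the
pair `(v, ∇v)`; the closure is taken in `L²(Ω) × L²(Ω; ℝᵈ)`, that is, for the topology of
`H¹(Ω)`. -/
def sobolevH10 (Ω : Opens (Space d)) : Submodule ℝ (L2 Ω × L2Vec Ω) :=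
  (LinearMap.range (testPair Ω)).topologicalClosure

/-- The space `V = H¹₀(D)`; its norm is defined below. -/
def V (D : Domain d) : Type := sobolevH10 D.carrier

instance (D : Domain d) : AddCommGroup (V D) := inferInstanceAs (AddCommGroup (sobolevH10 D.carrier))

instance (D : Domain d) : Module ℝ (V D) := inferInstanceAs (Module ℝ (sobolevH10 D.carrier))

/-- The function `v ∈ L²(D)` underlying an element of `V`. -/
def V.toL2 {D : Domain d} : V D →ₗ[ℝ] L2 D.carrier :=
  LinearMap.fst ℝ _ _ ∘ₗ (sobolevH10 D.carrier).subtype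

/-- The weak gradient `∇v ∈ L²(D; ℝᵈ)` of `v ∈ V`. -/
def V.grad {D : Domain d} : V D →ₗ[ℝ] L2Vec D.carrier :=
  LinearMap.snd ℝ _ _ ∘ₗ (sobolevH10 D.carrier).subtype

theorem norm_sq_L2 {F : Type*} [NormedAddCommGroup F] [InnerProductSpace ℝ F]
    {Ω : Opens (Space d)} (f : Lp F 2 (vol Ω)) : ‖f‖ ^ 2 = ∫ x in Ω, ‖f x‖ ^ 2 := by
  rw [← real_inner_self_eq_norm_sq, MeasureTheory.L2.inner_def]
  simp only [real_inner_self_eq_norm_sq]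

/-- The Friedrichs inequality for test functions. -/
theorem friedrichs_test {Ω : Opens (Space d)} (i : Fin d) {R : ℝ} (hR : 0 ≤ R)
    (hΩ : ∀ x ∈ Ω, ‖x‖ ≤ R) (φ : 𝓓(Ω, ℝ)) :
    ‖(testPair Ω φ).1‖ ≤ 2 * R * ‖(testPair Ω φ).2‖ := by
  have hφ := differentiable_test φ
  have hφc := φ.continuous
  have hs := φ.hasCompactSupport
  set e : Space d := EuclideanSpace.single i 1 with he
  have he1 : ‖e‖ = 1 := by simp [he]
  let L : Space d →L[ℝ] ℝ := EuclideanSpace.proj i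
  have hLe : L e = 1 := by simp [L, he]
  have hdc : Continuous fun x => fderiv ℝ φ x e :=
    (φ.contDiff.continuous_fderiv (by simp)).clm_apply continuous_const
  have hφ2 : ∀ x, fderiv ℝ (fun y => φ y ^ 2) x e = 2 * φ x * fderiv ℝ φ x e := fun x => by
    rw [((hφ x).hasFDerivAt.pow 2).fderiv]; simp
  have hcs2 : HasCompactSupport fun x => φ x ^ 2 := hs.comp_left (g := fun t => t ^ 2) (by simp)
  have hcs3 : HasCompactSupport fun x => 2 * φ x * fderiv ℝ φ x e * L x := by
    have : (fun x => 2 * φ x * fderiv ℝ φ x e * L x)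
        = fun x => φ x * (2 * fderiv ℝ φ x e * L x) := by ext; ring
    rw [this]; exact hs.mul_right
  have hcs4 : HasCompactSupport fun x => ‖gradient φ x‖ ^ 2 :=
    (hasCompactSupport_gradient φ).comp_left (g := fun y => ‖y‖ ^ 2) (by simp)
  have hi2 : Integrable fun x => φ x ^ 2 :=
    (hφc.pow 2).integrable_of_hasCompactSupport hcs2
  have hi3 : Integrable fun x => 2 * φ x * fderiv ℝ φ x e * L x :=
    (((continuous_const.mul hφc).mul hdc).mul L.continuous).integrable_of_hasCompactSupport hcs3
  have hi4 : Integrable fun x => ‖gradient φ x‖ ^ 2 :=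
    ((continuous_gradient φ).norm.pow 2).integrable_of_hasCompactSupport hcs4
  have key : ∫ x, φ x ^ 2 = - ∫ x, 2 * φ x * fderiv ℝ φ x e * L x := by
    have := integral_mul_fderiv_eq_neg_fderiv_mul_of_integrable (μ := (volume : Measure (Space d)))
      (f := fun x => φ x ^ 2) (g := L) (v := e) (by simpa only [hφ2] using hi3)
      (by simpa [hLe] using hi2)
      (((hφc.pow 2).mul L.continuous).integrable_of_hasCompactSupport hcs2.mul_right)
      (fun x _ => (hφ x).pow 2) (fun x _ => L.differentiableAt)
    simpa [hφ2, hLe] using this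
  have hbd : ∀ x, -(2 * φ x * fderiv ℝ φ x e * L x)
      ≤ (1 / 2) * φ x ^ 2 + 2 * R ^ 2 * ‖gradient φ x‖ ^ 2 := fun x => by
    by_cases hx : x ∈ Ω
    · have h1 : |L x| ≤ R := (by simpa [L] using PiLp.norm_apply_le x i : |L x| ≤ ‖x‖).trans (hΩ x hx)
      have h2 : |fderiv ℝ φ x e| ≤ ‖gradient φ x‖ := by
        have := (fderiv ℝ φ x).le_opNorm e
        simpa [gradient, he1] using this
      have h3 : |fderiv ℝ φ x e * L x| ≤ ‖gradient φ x‖ * R := by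
        rw [abs_mul]; gcongr
      have h4 := sq_nonneg (φ x + 2 * (fderiv ℝ φ x e * L x))
      have h5 := sq_le_sq' (abs_le.mp h3).1 (abs_le.mp h3).2
      nlinarith
    · have : φ x = 0 := image_eq_zero_of_notMem_tsupport fun h => hx (φ.tsupport_subset h)
      rw [this]
      simp only [mul_zero, zero_mul, neg_zero]
      positivity
  have hint : ∫ x, φ x ^ 2 ≤ (1 / 2) * (∫ x, φ x ^ 2) + 2 * R ^ 2 * ∫ x, ‖gradient φ x‖ ^ 2 := by
    rw [← integral_const_mul, ← integral_const_mul, ← integral_add (hi2.const_mul _)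
      (hi4.const_mul _)]
    conv_lhs => rw [key, ← integral_neg]
    exact integral_mono hi3.neg ((hi2.const_mul _).add (hi4.const_mul _)) hbd
  have hn1 : ‖(testPair Ω φ).1‖ ^ 2 = ∫ x, φ x ^ 2 := by
    rw [norm_sq_L2, ← setIntegral_eq_integral_of_forall_compl_eq_zero (s := (Ω : Set (Space d)))
      (f := fun x => φ x ^ 2)]
    · refine integral_congr_ae ?_
      filter_upwards [(memLp_test φ).coeFn_toLp] with x hx
      change ‖(memLp_test φ).toLp φ x‖ ^ 2 = _
      rw [hx, Real.norm_eq_abs, sq_abs]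
    · intro x hx
      rw [image_eq_zero_of_notMem_tsupport fun h => hx (φ.tsupport_subset h)]; simp
  have hn2 : ‖(testPair Ω φ).2‖ ^ 2 = ∫ x, ‖gradient φ x‖ ^ 2 := by
    rw [norm_sq_L2, ← setIntegral_eq_integral_of_forall_compl_eq_zero (s := (Ω : Set (Space d)))
      (f := fun x => ‖gradient φ x‖ ^ 2)]
    · refine integral_congr_ae ?_
      filter_upwards [(memLp_gradient φ).coeFn_toLp] with x hx
      change ‖(memLp_gradient φ).toLp (gradient φ) x‖ ^ 2 = _
      rw [hx]
    · intro x hx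
      have : fderiv ℝ φ x = 0 := image_eq_zero_of_notMem_tsupport fun h =>
        hx (φ.tsupport_subset (tsupport_fderiv_subset ℝ h))
      simp [gradient, this]
  refine le_of_sq_le_sq ?_ (by positivity)
  rw [hn1, mul_pow, hn2]
  linarith

/-- The Friedrichs inequality on `V`: `‖v‖_{L²} ≤ C ‖∇v‖_{L²}`. -/
theorem V.friedrichs (D : Domain d) : ∃ C : ℝ, ∀ v : V D, ‖V.toL2 v‖ ≤ C * ‖V.grad v‖ := by
  obtain ⟨R, hR⟩ := D.bounded.exists_norm_le
  have hd : 0 < d := by have := D.dim; omega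
  obtain ⟨x₀, hx₀⟩ := D.nonempty
  have hR0 : 0 ≤ R := (norm_nonneg x₀).trans (hR x₀ hx₀)
  refine ⟨2 * R, fun v => ?_⟩
  have hcl : IsClosed {p : L2 D.carrier × L2Vec D.carrier | ‖p.1‖ ≤ 2 * R * ‖p.2‖} :=
    isClosed_le (by fun_prop) (by fun_prop)
  have hsub : ((LinearMap.range (testPair D.carrier)).topologicalClosure :
      Set (L2 D.carrier × L2Vec D.carrier)) ⊆ {p | ‖p.1‖ ≤ 2 * R * ‖p.2‖} := by
    rw [Submodule.topologicalClosure_coe]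
    refine closure_minimal ?_ hcl
    rintro _ ⟨φ, rfl⟩
    exact friedrichs_test ⟨0, hd⟩ hR0 (fun x hx => hR x hx) φ
  exact hsub v.2

theorem V.grad_injective (D : Domain d) : Function.Injective (V.grad (D := D)) := by
  rw [injective_iff_map_eq_zero]
  intro v hv
  obtain ⟨C, hC⟩ := V.friedrichs D
  have h1 : V.toL2 v = 0 := by simpa [hv] using hC v
  exact Subtype.ext (Prod.ext h1 hv)

/-- `V` is normed by `‖v‖_V = ‖∇v‖_{L²(D)}`. -/
instance (D : Domain d) : NormedAddCommGroup (V D) :=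
  NormedAddCommGroup.induced (V D) (L2Vec D.carrier) V.grad (V.grad_injective D)

instance (D : Domain d) : NormedSpace ℝ (V D) := NormedSpace.induced ℝ (V D) (L2Vec D.carrier) V.grad

/-! ### The parametric problem -/

/-- The coefficient `a(x, z) = exp (∑ⱼ zⱼ aⱼ(x))`. -/
def coeff {s : ℕ} (a : Fin s → Space d → ℝ) (z : Fin s → ℝ) (x : Space d) : ℝ :=
  Real.exp (∑ j, z j * a j x)

/-- `a_min(z)`, the (essential) infimum of `a(·, z)` over `D`. -/
def aMin {s : ℕ} (D : Domain d) (a : Fin s → Space d → ℝ) (z : Fin s → ℝ) : ℝ :=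
  essInf (coeff a z) (vol D.carrier)

/-- The source `ℓ(·, w) = ℓ̄ + ∑ᵢ wᵢ ℓᵢ` in `V* = H⁻¹(D)`. -/
def source {s : ℕ} {D : Domain d} (lbar : StrongDual ℝ (V D))
    (l : Fin (s + 1) → StrongDual ℝ (V D)) (w : Fin (s + 1) → ℝ) : StrongDual ℝ (V D) :=
  lbar + ∑ i, w i • l i

/-- The bilinear form `𝒜(z; u, v) = ∫_D a(x, z) ∇u(x) · ∇v(x) dx`. -/
def bilin {s : ℕ} {D : Domain d} (a : Fin s → Space d → ℝ) (z : Fin s → ℝ) (u v : V D) : ℝ :=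
  ∫ x in D.carrier, coeff a z x * ⟪V.grad u x, V.grad v x⟫_ℝ

/-- The part `w = (y₀, …, y_s)` of `y = (w, z)`; also used for multi-indices `ν = (ν_w, ν_z)`. -/
def wPart {α : Type} {s : ℕ} (y : Fin (s + 1 + s) → α) : Fin (s + 1) → α :=
  fun i => y (Fin.castAdd s i)

/-- The part `z = (y_{s+1}, …, y_{2s})` of `y = (w, z)`; also used for multi-indices. -/
def zPart {α : Type} {s : ℕ} (y : Fin (s + 1 + s) → α) : Fin s → α :=
  fun j => y (Fin.natAdd (s + 1) j)

/-- `u ∈ V` solves the variational problem with parameter `y = (w, z)`: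
`𝒜(z; u, v) = ⟨ℓ(·, w), v⟩` for all `v ∈ V`. -/
def IsSolution {s : ℕ} {D : Domain d} (a : Fin s → Space d → ℝ) (lbar : StrongDual ℝ (V D))
    (l : Fin (s + 1) → StrongDual ℝ (V D)) (y : Fin (s + 1 + s) → ℝ) (u : V D) : Prop :=
  ∀ v : V D, bilin a (zPart y) u v = source lbar l (wPart y) v

/-- The functional `l ∈ V*` is given by a function `f ∈ L^∞(D)` with (essential) infimum
`> 0`: `⟨l, v⟩ = ∫_D f v`. -/
def IsPositiveBounded {D : Domain d} (l : StrongDual ℝ (V D)) : Prop :=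
  ∃ f : Space d → ℝ, MemLp f ∞ (vol D.carrier) ∧
    (∃ m : ℝ, 0 < m ∧ ∀ᵐ x ∂(vol D.carrier), m ≤ f x) ∧
    ∀ v : V D, l v = ∫ x in D.carrier, f x * V.toL2 v x

/-- `‖f‖_{L^∞(D)}`. -/
def normLInfty (D : Domain d) (f : Space d → ℝ) : ℝ := (eLpNorm f ∞ (vol D.carrier)).toReal

/-! ### Mixed partial derivatives -/

/-- The partial derivative `∂ⁱ f` of `f : ℝⁿ → F`. -/
def partialDeriv {F : Type} [NormedAddCommGroup F] [NormedSpace ℝ F] {n : ℕ} (i : Fin n)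
    (f : (Fin n → ℝ) → F) : (Fin n → ℝ) → F :=
  fun y => lineDeriv ℝ f y (Pi.single i 1)

/-- The mixed derivative `∂^ν f = ∏ᵢ (∂ⁱ)^{νᵢ} f` of `f : ℝⁿ → F`. -/
def mixedDeriv {F : Type} [NormedAddCommGroup F] [NormedSpace ℝ F] {n : ℕ} (ν : Fin n → ℕ)
    (f : (Fin n → ℝ) → F) : (Fin n → ℝ) → F :=
  (List.finRange n).foldr (fun i g => (partialDeriv i)^[ν i] g) f

end LognormalPDE

end

open LognormalPDE

/-!
Write `M_j` for the multiplication with `a_j` on `L²(D; ℝᵈ)`. The operators `M_j` are self-adjoint,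
commute, have norm at most `b_j`, and the multiplication with `a(·, z)` is `exp (∑ⱼ zⱼ M_j)`
(`coeFn_exp_mulOp`, `coeFn_expOp_exponentOp`). So the problem is a linear equation in the Hilbert
space `V` whose operator depends on `z` through an exponential, and whose right-hand side is affine
in `w`. The operator is coercive with constant `a_min(z) > 0`; existence and uniqueness are
Lax–Milgram (`exists_equiv_of_coercive`), and smoothness follows from the smoothness of `exp` and
of operator inversion (`contDiff_of_equiv`).

For the bounds, the equation is differentiated along a list of directions by the Leibniz rule
(`splitSum_pullForm_listDeriv`): for a list `L`,
`∑ ∫_D a(·, z) (∏_{i ∈ P} a_i) ∇(∂^Q u) · ∇v = (∂^L ℓ)(v)`, where `(P, Q)` runs over the `2 ^ |L|`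
splittings of `L`. Here a direction `w_i` counts as one with multiplier `a_i = 0`, so that all cases
of the theorem are instances of one estimate (`norm_listDeriv_le`). The term with `P = []` is the
operator applied to `∂^L u`; testing with `v = ∂^L u` bounds it by the others. In the energy norm
`(∫_D a(·, z) |∇v|²)^{1/2}` the multiplier `∏_{i ∈ P} a_i` costs the factor `∏_{i ∈ P} b_i`, without
a quotient of the bounds of `a(·, z)`. With `n` derivatives in `z`, this leaves the recursion
`Λ n = ∑_{k < n} (n choose k) Λ k`, which `n! / (ln 2)ⁿ` satisfies as a supersolution
(`sum_choose_mul_factorial_div_log_two_le`). The two passages between the energy norm and the norms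
of `V` and `V*` give the factor `1 / a_min(z)`.
-/

namespace LognormalPDE

noncomputable section

/-! ### Sums over the splittings of a list of directions -/

section SplitSum

variable {ι : Type*}

/-- The sum of `F P Q` over the `2 ^ L.length` ways to distribute the entries of the list `L` on
two lists `P` and `Q`, keeping their order. These are the index pairs of the Leibniz rule for a
product differentiated in the directions `L`. -/
def splitSum {X : Type*} [AddCommMonoid X] : List ι → (List ι → List ι → X) → X
  | [], F => F [] []
  | i :: L, F => splitSum L (fun P Q => F (i :: P) Q) + splitSum L (fun P Q => F P (i :: Q))

theorem splitSum_add {X : Type*} [AddCommMonoid X] (L : List ι) (F G : List ι → List ι → X) :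
    splitSum L (fun P Q => F P Q + G P Q) = splitSum L F + splitSum L G := by
  induction L generalizing F G with
  | nil => rfl
  | cons i L ih => simp only [splitSum, ih]; abel

theorem splitSum_mul_right (L : List ι) (F : List ι → List ι → ℝ) (c : ℝ) :
    splitSum L (fun P Q => F P Q * c) = splitSum L F * c := by
  induction L generalizing F with
  | nil => rfl
  | cons i L ih => simp only [splitSum, ih, add_mul]

theorem splitSum_zero {X : Type*} [AddCommMonoid X] (L : List ι) :
    splitSum L (fun _ _ => (0 : X)) = 0 := by
  induction L with
  | nil => rfl
  | cons i L ih => simp only [splitSum, ih, add_zero]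

theorem map_splitSum {X Y : Type*} [AddCommMonoid X] [AddCommMonoid Y] (φ : X →+ Y) (L : List ι)
    (F : List ι → List ι → X) : φ (splitSum L F) = splitSum L (fun P Q => φ (F P Q)) := by
  induction L generalizing F with
  | nil => rfl
  | cons i L ih => simp only [splitSum, map_add, ih]

/-- The only splitting with empty first part has second part `L`. -/
theorem splitSum_eq_add {X : Type*} [AddCommMonoid X] (L : List ι) (F : List ι → List ι → X) :
    splitSum L F = F [] L + splitSum L (fun P Q => if P = [] then 0 else F P Q) := by
  induction L generalizing F with
  | nil => simp [splitSum]
  | cons i L ih =>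
    simp only [splitSum, reduceCtorEq, if_false]
    rw [ih fun P Q => F P (i :: Q)]
    abel

theorem norm_splitSum_le {X : Type*} [NormedAddCommGroup X] (L : List ι)
    (F : List ι → List ι → X) : ‖splitSum L F‖ ≤ splitSum L (fun P Q => ‖F P Q‖) := by
  induction L generalizing F with
  | nil => exact le_rfl
  | cons i L ih => exact (norm_add_le _ _).trans (add_le_add (ih _) (ih _))

theorem splitSum_le_splitSum (L : List ι) (F G : List ι → List ι → ℝ)
    (h : ∀ P Q, (P ++ Q).Perm L → F P Q ≤ G P Q) : splitSum L F ≤ splitSum L G := by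
  induction L generalizing F G with
  | nil => exact h _ _ (List.Perm.refl _)
  | cons i L ih =>
    exact add_le_add (ih _ _ fun P Q hPQ => h _ _ (hPQ.cons i))
      (ih _ _ fun P Q hPQ => h _ _ (List.perm_middle.trans (hPQ.cons i)))

theorem hasDerivAt_splitSum {X : Type*} [NormedAddCommGroup X] [NormedSpace ℝ X] (L : List ι)
    (F : ℝ → List ι → List ι → X) (F' : List ι → List ι → X) (t : ℝ)
    (h : ∀ P Q, HasDerivAt (fun τ => F τ P Q) (F' P Q) t) :
    HasDerivAt (fun τ => splitSum L (F τ)) (splitSum L F') t := by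
  induction L generalizing F F' with
  | nil => exact h _ _
  | cons i L ih => exact (ih _ _ fun P Q => h _ _).add (ih _ _ fun P Q => h _ _)

/-- Counting splittings: if the first part may only take entries with property `p`, then
`(n choose k)` of them leave `k` such entries in the second part, where `n` of the entries of `L`
have the property. -/
theorem splitSum_countP (p : ι → Prop) [DecidablePred p] (L : List ι) (g : ℕ → ℝ) :
    splitSum L (fun P Q => if ∀ i ∈ P, p i then g (Q.countP (p ·)) else 0)
      = ∑ k ∈ Finset.range (L.countP (p ·) + 1), ((L.countP (p ·)).choose k : ℝ) * g k := by
  induction L generalizing g with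
  | nil => simp [splitSum]
  | cons i L ih =>
    by_cases hi : p i
    · have h1 := Finset.sum_choose_succ_mul (fun k _ => g k) (L.countP (p ·))
      simp only [splitSum, List.forall_mem_cons, hi, true_and, List.countP_cons, decide_true,
        if_true]
      rw [ih, ih fun k => g (k + 1), h1]
    · simp only [splitSum, List.forall_mem_cons, hi, false_and, if_false, List.countP_cons,
        decide_false, Bool.false_eq_true, add_zero, splitSum_zero, zero_add]
      exact ih g

end SplitSum

/-! ### The sequence `n! / (ln 2)ⁿ` -/

/-- The sequence `n! / (ln 2)ⁿ` dominates the recursion `Λ n = ∑_{k < n} (n choose k) Λ k` of the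
ordered Bell numbers, because `∑_{m ≥ 1} (ln 2)ᵐ / m! = exp (ln 2) - 1 = 1`. -/
theorem sum_choose_mul_factorial_div_log_two_le {n : ℕ} :
    ∑ k ∈ Finset.range n, (n.choose k : ℝ) * (k.factorial / Real.log 2 ^ k)
      ≤ n.factorial / Real.log 2 ^ n := by
  have hlog : 0 < Real.log 2 := Real.log_pos (by norm_num)
  have hterm : ∀ k ∈ Finset.range n, (n.choose k : ℝ) * (k.factorial / Real.log 2 ^ k)
      = n.factorial / Real.log 2 ^ n * (Real.log 2 ^ (n - k) / (n - k).factorial) := by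
    intro k hk
    have hkn : k ≤ n := (Finset.mem_range.mp hk).le
    have h1 : (n.choose k : ℝ) * k.factorial * (n - k).factorial = n.factorial := by
      exact_mod_cast Nat.choose_mul_factorial_mul_factorial hkn
    have h2 : Real.log 2 ^ n = Real.log 2 ^ k * Real.log 2 ^ (n - k) := by
      rw [← pow_add, Nat.add_sub_cancel' hkn]
    have h3 : ((n - k).factorial : ℝ) ≠ 0 := by positivity
    rw [← h1, h2]
    field_simp
  rw [Finset.sum_congr rfl hterm, ← Finset.mul_sum]
  refine mul_le_of_le_one_right (by positivity) ?_
  have h1 := Real.sum_le_exp_of_nonneg hlog.le (n + 1)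
  rw [Real.exp_log (by norm_num), ← Finset.sum_range_reflect, Finset.sum_range_succ] at h1
  have h2 : ∑ k ∈ Finset.range n, Real.log 2 ^ (n + 1 - 1 - k) / (n + 1 - 1 - k).factorial
      = ∑ k ∈ Finset.range n, Real.log 2 ^ (n - k) / (n - k).factorial := by simp
  rw [h2] at h1
  simp only [add_tsub_cancel_right, tsub_self, pow_zero, Nat.factorial_zero, Nat.cast_one,
    div_one] at h1
  linarith

/-- The factor `n! / (ln 2)ⁿ` survives one step of the Leibniz recursion, whose sum leaves out
the splitting with empty first part. -/
theorem splitSum_factorial_div_log_two_le {ι : Type*} (p : ι → Prop) [DecidablePred p]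
    (L : List ι) :
    splitSum L (fun P Q => if P = [] then 0 else
        if ∀ i ∈ P, p i then ((Q.countP (p ·)).factorial : ℝ) / Real.log 2 ^ Q.countP (p ·) else 0)
      ≤ if L.countP (p ·) = 0 then 0 else
        ((L.countP (p ·)).factorial : ℝ) / Real.log 2 ^ L.countP (p ·) := by
  have h1 := splitSum_countP p L fun k => (k.factorial : ℝ) / Real.log 2 ^ k
  rw [splitSum_eq_add, Finset.sum_range_succ, Nat.choose_self] at h1
  simp only [List.not_mem_nil, false_implies, implies_true, if_true, Nat.cast_one, one_mul] at h1
  have h2 := sum_choose_mul_factorial_div_log_two_le (n := L.countP (p ·))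
  split_ifs with h0
  · rw [h0] at h1
    simp only [Finset.range_zero, Finset.sum_empty] at h1
    linarith
  · linarith

/-! ### Iterated partial derivatives along a list of directions -/

section ListDeriv

variable {F : Type} [NormedAddCommGroup F] [NormedSpace ℝ F] {n : ℕ}

/-- The iterated partial derivative in the directions of the list `L`; the head of `L` is applied
last. -/
def listDeriv (L : List (Fin n)) (f : (Fin n → ℝ) → F) : (Fin n → ℝ) → F :=
  L.foldr partialDeriv f

theorem contDiff_partialDeriv {f : (Fin n → ℝ) → F} (hf : ContDiff ℝ (⊤ : ℕ∞) f) (i : Fin n) :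
    ContDiff ℝ (⊤ : ℕ∞) (partialDeriv i f) := by
  have h : partialDeriv i f = fun y => fderiv ℝ f y (Pi.single i 1) := by
    ext1 y
    exact (hf.differentiable (by simp) y).lineDeriv_eq_fderiv
  rw [h]
  exact (hf.fderiv_right (m := (⊤ : ℕ∞)) (by simp)).clm_apply contDiff_const

theorem contDiff_listDeriv {f : (Fin n → ℝ) → F} (hf : ContDiff ℝ (⊤ : ℕ∞) f)
    (L : List (Fin n)) : ContDiff ℝ (⊤ : ℕ∞) (listDeriv L f) := by
  induction L with
  | nil => exact hf
  | cons i L ih => exact contDiff_partialDeriv ih i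

theorem hasDerivAt_listDeriv {f : (Fin n → ℝ) → F} (hf : ContDiff ℝ (⊤ : ℕ∞) f) (i : Fin n)
    (L : List (Fin n)) (y : Fin n → ℝ) :
    HasDerivAt (fun t : ℝ => listDeriv L f (y + t • Pi.single i 1)) (listDeriv (i :: L) f y) 0 :=
  (((contDiff_listDeriv hf L).differentiable (by simp) y).lineDifferentiableAt).hasLineDerivAt

/-- The list of directions that belongs to the multi-index `ν`. -/
def directions (ν : Fin n → ℕ) : List (Fin n) :=
  (List.finRange n).flatMap fun i => List.replicate (ν i) i

theorem mixedDeriv_eq_listDeriv (ν : Fin n → ℕ) (f : (Fin n → ℝ) → F) :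
    mixedDeriv ν f = listDeriv (directions ν) f := by
  have hrep : ∀ (i : Fin n) (k : ℕ) (g : (Fin n → ℝ) → F),
      (partialDeriv i)^[k] g = (List.replicate k i).foldr partialDeriv g := by
    intro i k g
    induction k with
    | zero => rfl
    | succ k ih => rw [Function.iterate_succ_apply', ih, List.replicate_succ, List.foldr_cons]
  unfold mixedDeriv listDeriv directions
  induction List.finRange n with
  | nil => rfl
  | cons i R ih => rw [List.foldr_cons, List.flatMap_cons, List.foldr_append, ih, hrep]

theorem count_directions (ν : Fin n → ℕ) (i : Fin n) : (directions ν).count i = ν i := by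
  rw [directions, List.count_flatMap, ← List.ofFn_eq_map, List.sum_ofFn]
  simp [List.count_replicate]

end ListDeriv

/-! ### Linear problems whose operator depends exponentially on the parameter -/

section Abstract

-- Instances on nested spaces of operators are not found at the default depth.
set_option maxSynthPendingDepth 3

variable {W E : Type} [NormedAddCommGroup W] [InnerProductSpace ℝ W]
  [NormedAddCommGroup E] [InnerProductSpace ℝ E] {n : ℕ}

/-- `exp (∑ᵢ yᵢ Mᵢ)`. -/
def expOp (M : Fin n → E →L[ℝ] E) (y : Fin n → ℝ) : E →L[ℝ] E :=
  NormedSpace.exp (∑ i, y i • M i)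

/-- The product of the operators `Mᵢ` over the list `P`. -/
def prodOp (M : Fin n → E →L[ℝ] E) : List (Fin n) → E →L[ℝ] E
  | [] => 1
  | i :: P => prodOp M P * M i

/-- The bilinear form `(u, v) ↦ ⟪T (G u), G v⟫` on `W`, as a function of the operator `T`. -/
def pullForm (G : W →L[ℝ] E) : (E →L[ℝ] E) →L[ℝ] (W →L[ℝ] StrongDual ℝ W) :=
  ContinuousLinearMap.compL ℝ W E (StrongDual ℝ W)
      ((ContinuousLinearMap.compL ℝ W E ℝ).flip G ∘L innerSL ℝ) ∘L
    (ContinuousLinearMap.compL ℝ W E E).flip G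

theorem pullForm_apply (G : W →L[ℝ] E) (T : E →L[ℝ] E) (u v : W) :
    pullForm G T u v = ⟪T (G u), G v⟫_ℝ := rfl

variable {M : Fin n → E →L[ℝ] E}

theorem contDiff_expOp [CompleteSpace E] (M : Fin n → E →L[ℝ] E) :
    ContDiff ℝ (⊤ : ℕ∞) (expOp M) := by
  have h : ContDiff ℝ (⊤ : ℕ∞) (NormedSpace.exp : (E →L[ℝ] E) → (E →L[ℝ] E)) :=
    contDiff_iff_contDiffAt.mpr fun T => (NormedSpace.exp_analytic (𝕂 := ℝ) T).contDiffAt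
  exact h.comp (by fun_prop)

theorem commute_sum_smul (hM : ∀ i j, Commute (M i) (M j)) (y y' : Fin n → ℝ) :
    Commute (∑ i, y i • M i) (∑ i, y' i • M i) :=
  Commute.sum_left _ _ _ fun i _ => Commute.sum_right _ _ _ fun j _ =>
    ((hM i j).smul_left _).smul_right _

theorem expOp_add [CompleteSpace E] (hM : ∀ i j, Commute (M i) (M j)) (y y' : Fin n → ℝ) :
    expOp M (y + y') = expOp M y * expOp M y' := by
  unfold expOp
  let _ : NormedAlgebra ℚ (E →L[ℝ] E) := NormedAlgebra.restrictScalars ℚ ℝ _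
  rw [← NormedSpace.exp_add_of_commute (commute_sum_smul hM y y')]
  simp only [Pi.add_apply, add_smul, Finset.sum_add_distrib]

theorem hasDerivAt_expOp [CompleteSpace E] (hM : ∀ i j, Commute (M i) (M j)) (y : Fin n → ℝ)
    (i : Fin n) :
    HasDerivAt (fun t : ℝ => expOp M (y + t • Pi.single i 1)) (M i * expOp M y) 0 := by
  have h : ∀ t : ℝ, expOp M (y + t • Pi.single i 1) = NormedSpace.exp (t • M i) * expOp M y := by
    intro t
    rw [add_comm, expOp_add hM]
    have hsum : ∑ j, (t • Pi.single i (1 : ℝ) : Fin n → ℝ) j • M j = t • M i := by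
      rw [Finset.sum_eq_single i (fun j _ hj => by simp [hj]) (by simp)]
      simp
    unfold expOp
    rw [hsum]
  simp only [h]
  simpa using (hasDerivAt_exp_smul_const (𝕂 := ℝ) (M i) (0 : ℝ)).mul_const (expOp M y)

theorem expOp_half_mul_self [CompleteSpace E] (hM : ∀ i j, Commute (M i) (M j)) (y : Fin n → ℝ) :
    expOp M ((2⁻¹ : ℝ) • y) * expOp M ((2⁻¹ : ℝ) • y) = expOp M y := by
  rw [← expOp_add hM, ← add_smul]; norm_num

theorem isSelfAdjoint_expOp [CompleteSpace E] (hs : ∀ i, IsSelfAdjoint (M i)) (y : Fin n → ℝ) :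
    IsSelfAdjoint (expOp M y) := by
  let _ : NormedAlgebra ℚ (E →L[ℝ] E) := NormedAlgebra.restrictScalars ℚ ℝ _
  refine IsSelfAdjoint.exp ?_
  exact isSelfAdjoint_sum _ fun i _ => (IsSelfAdjoint.all (y i)).smul (hs i)

theorem commute_prodOp_expOp (hM : ∀ i j, Commute (M i) (M j)) (P : List (Fin n))
    (y : Fin n → ℝ) : Commute (prodOp M P) (expOp M y) := by
  induction P with
  | nil => exact Commute.one_left _
  | cons i P ih =>
    refine ih.mul_left ?_
    let _ : NormedAlgebra ℚ (E →L[ℝ] E) := NormedAlgebra.restrictScalars ℚ ℝ _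
    exact (Commute.sum_right _ _ _ fun j _ => (hM i j).smul_right _).exp_right

/-- The form belonging to a product of the operators is controlled by the energy norms
`‖exp (½ ∑ᵢ yᵢ Mᵢ) G u‖`: one half of the exponential is moved to the other argument. -/
theorem abs_pullForm_prodOp_mul_expOp_le [CompleteSpace E] (hM : ∀ i j, Commute (M i) (M j))
    (hs : ∀ i, IsSelfAdjoint (M i)) (G : W →L[ℝ] E) (P : List (Fin n)) (y : Fin n → ℝ)
    (u v : W) :
    |pullForm G (prodOp M P * expOp M y) u v| ≤
      ‖prodOp M P‖ * ‖expOp M ((2⁻¹ : ℝ) • y) (G u)‖ * ‖expOp M ((2⁻¹ : ℝ) • y) (G v)‖ := by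
  have h1 : prodOp M P * expOp M y
      = expOp M ((2⁻¹ : ℝ) • y) * (prodOp M P * expOp M ((2⁻¹ : ℝ) • y)) := by
    rw [← mul_assoc, ← (commute_prodOp_expOp hM P _).eq, mul_assoc, expOp_half_mul_self hM]
  rw [pullForm_apply, h1]
  have h2 := (ContinuousLinearMap.isSelfAdjoint_iff_isSymmetric.mp
    (isSelfAdjoint_expOp hs ((2⁻¹ : ℝ) • y))) (prodOp M P (expOp M ((2⁻¹ : ℝ) • y) (G u))) (G v)
  change |⟪expOp M ((2⁻¹ : ℝ) • y) (prodOp M P (expOp M ((2⁻¹ : ℝ) • y) (G u))), G v⟫_ℝ| ≤ _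
  rw [ContinuousLinearMap.coe_coe] at h2
  rw [h2]
  exact (abs_real_inner_le_norm _ _).trans (by gcongr; exact ContinuousLinearMap.le_opNorm _ _)

theorem pullForm_expOp_self [CompleteSpace E] (hM : ∀ i j, Commute (M i) (M j))
    (hs : ∀ i, IsSelfAdjoint (M i)) (G : W →L[ℝ] E) (y : Fin n → ℝ) (v : W) :
    pullForm G (expOp M y) v v = ‖expOp M ((2⁻¹ : ℝ) • y) (G v)‖ ^ 2 := by
  rw [pullForm_apply, ← expOp_half_mul_self hM, ← real_inner_self_eq_norm_sq]
  exact (ContinuousLinearMap.isSelfAdjoint_iff_isSymmetric.mp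
    (isSelfAdjoint_expOp hs ((2⁻¹ : ℝ) • y))) _ _

/-- Lax–Milgram, as an isomorphism onto the dual space. -/
theorem exists_equiv_of_coercive [CompleteSpace W] {B : W →L[ℝ] StrongDual ℝ W} {α : ℝ}
    (hα : 0 < α) (hB : ∀ v, α * ‖v‖ ^ 2 ≤ B v v) :
    ∃ e : W ≃L[ℝ] StrongDual ℝ W, (e : W →L[ℝ] _) = B := by
  have hc : IsCoercive B := ⟨α, hα, fun v => by rw [mul_assoc, ← sq]; exact hB v⟩
  refine ⟨hc.continuousLinearEquivOfBilin.trans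
    (InnerProductSpace.toDual ℝ W).toContinuousLinearEquiv, ?_⟩
  ext v w
  exact hc.continuousLinearEquivOfBilin_apply v w

/-- The solution of a linear equation depends smoothly on the parameter if the operator, which is
to be invertible, and the right-hand side do. -/
theorem contDiff_of_equiv {X Y Z : Type*} [NormedAddCommGroup X] [NormedSpace ℝ X]
    [CompleteSpace X] [NormedAddCommGroup Y] [NormedSpace ℝ Y] [NormedAddCommGroup Z]
    [NormedSpace ℝ Z] {B : Z → X →L[ℝ] Y} {σ : Z → Y} {u : Z → X} {m : ℕ∞}
    (hB : ContDiff ℝ m B) (hσ : ContDiff ℝ m σ)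
    (he : ∀ y, ∃ e : X ≃L[ℝ] Y, (e : X →L[ℝ] Y) = B y) (hu : ∀ y, B y (u y) = σ y) :
    ContDiff ℝ m u := by
  have h : u = fun y => (B y).inverse (σ y) := by
    ext1 y
    obtain ⟨e, he⟩ := he y
    rw [← he, ContinuousLinearMap.inverse_equiv, ← hu, ← he]
    simp
  rw [h, contDiff_iff_contDiffAt]
  intro y
  obtain ⟨e, he⟩ := he y
  have hinv : ContDiffAt ℝ m ContinuousLinearMap.inverse (B y) := he ▸ contDiffAt_map_inverse e
  exact (hinv.comp y hB.contDiffAt).clm_apply hσ.contDiffAt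

/-- The variational equation differentiated in the directions `L`, by the Leibniz rule. Here
`σ L` is the derivative of the right-hand side `σ []` in the directions `L`. -/
theorem splitSum_pullForm_listDeriv [CompleteSpace E]
    (hM : ∀ i j, Commute (M i) (M j)) (G : W →L[ℝ] E)
    {u : (Fin n → ℝ) → W} (hu : ContDiff ℝ (⊤ : ℕ∞) u)
    {σ : List (Fin n) → (Fin n → ℝ) → StrongDual ℝ W}
    (hσ : ∀ L i y, HasDerivAt (fun t : ℝ => σ L (y + t • Pi.single i 1)) (σ (i :: L) y) 0)
    (heq : ∀ y, pullForm G (expOp M y) (u y) = σ [] y) (L : List (Fin n)) (y : Fin n → ℝ) :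
    splitSum L (fun P Q => pullForm G (prodOp M P * expOp M y) (listDeriv Q u y)) = σ L y := by
  induction L generalizing y with
  | nil => simpa [splitSum, prodOp, listDeriv] using heq y
  | cons i L ih =>
    refine HasDerivAt.unique ?_ (hσ L i y)
    simp only [← ih]
    have key : ∀ P Q, HasDerivAt
        (fun t : ℝ => pullForm G (prodOp M P * expOp M (y + t • Pi.single i 1))
          (listDeriv Q u (y + t • Pi.single i 1)))
        (pullForm G (prodOp M (i :: P) * expOp M y) (listDeriv Q u y)
          + pullForm G (prodOp M P * expOp M y) (listDeriv (i :: Q) u y)) 0 := by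
      intro P Q
      have h1 := (pullForm G).hasFDerivAt.comp_hasDerivAt (0 : ℝ)
        ((hasDerivAt_expOp hM y i).const_mul (prodOp M P))
      have h2 := h1.clm_apply (hasDerivAt_listDeriv hu i Q y)
      simpa [prodOp, mul_assoc] using h2
    have h := hasDerivAt_splitSum L _ _ 0 key
    rw [splitSum_add] at h
    exact h

theorem norm_prodOp_le {b : Fin n → ℝ} (hb : ∀ i, ‖M i‖ ≤ b i) (P : List (Fin n)) :
    ‖prodOp M P‖ ≤ (P.map b).prod := by
  induction P with
  | nil => exact ContinuousLinearMap.norm_id_le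
  | cons i P ih =>
    rw [List.map_cons, List.prod_cons, mul_comm]
    exact (norm_mul_le _ _).trans
      (mul_le_mul ih (hb i) (norm_nonneg _) ((norm_nonneg _).trans ih))

theorem prodOp_eq_zero {P : List (Fin n)} {i : Fin n} (hi : i ∈ P) (h : M i = 0) :
    prodOp M P = 0 := by
  induction P with
  | nil => simp at hi
  | cons j P ih =>
    rcases List.mem_cons.mp hi with rfl | hi
    · rw [prodOp, h, mul_zero]
    · rw [prodOp, ih hi, zero_mul]

/-- The bound for the iterated derivatives of the solution. The directions are of two kinds: those
with property `p`, on which only the operator depends, and the others, on which only the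
right-hand side depends. The proof is an induction in the energy norm `‖exp (½ ∑ᵢ yᵢ Mᵢ) G v‖`,
which makes the constants independent of the contrast of the operator; `α` enters only twice,
through `‖v‖_W` and through the dual norm of the right-hand side. -/
theorem norm_listDeriv_le [CompleteSpace E] (p : Fin n → Prop) [DecidablePred p]
    (hM : ∀ i j, Commute (M i) (M j)) (hs : ∀ i, IsSelfAdjoint (M i))
    {b : Fin n → ℝ} (hb : ∀ i, ‖M i‖ ≤ b i) (hM0 : ∀ i, ¬ p i → M i = 0) (G : W →L[ℝ] E)
    {u : (Fin n → ℝ) → W} (hu : ContDiff ℝ (⊤ : ℕ∞) u)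
    {σ : List (Fin n) → (Fin n → ℝ) → StrongDual ℝ W}
    (hσ : ∀ L i y, HasDerivAt (fun t : ℝ => σ L (y + t • Pi.single i 1)) (σ (i :: L) y) 0)
    (heq : ∀ y, pullForm G (expOp M y) (u y) = σ [] y)
    (hperm : ∀ L L' y, L.Perm L' → σ L y = σ L' y)
    (hσ0 : ∀ L i y, i ∈ L → p i → σ L y = 0)
    (y : Fin n → ℝ) {α : ℝ} (hα : 0 < α)
    (hcoer : ∀ v, α * ‖v‖ ^ 2 ≤ pullForm G (expOp M y) v v) (L : List (Fin n)) :
    ‖listDeriv L u y‖ ≤ (L.countP (p ·)).factorial / Real.log 2 ^ L.countP (p ·) *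
      ((L.filter (p ·)).map b).prod * (‖σ (L.filter (¬ p ·)) y‖ / α) := by
  have hb0 : ∀ i, 0 ≤ b i := fun i => (norm_nonneg _).trans (hb i)
  have hlog : 0 < Real.log 2 := Real.log_pos (by norm_num)
  have hsq : 0 < √α := Real.sqrt_pos.mpr hα
  have hprod : ∀ L : List (Fin n), 0 ≤ (L.map b).prod := fun L =>
    List.prod_nonneg fun x hx => by
      obtain ⟨i, -, rfl⟩ := List.mem_map.mp hx
      exact hb0 i
  set en : W → ℝ := fun v => ‖expOp M ((2⁻¹ : ℝ) • y) (G v)‖ with hen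
  have hen0 : ∀ v, 0 ≤ en v := fun v => norm_nonneg _
  have hVen : ∀ v, ‖v‖ ≤ en v / √α := by
    intro v
    have h := hcoer v
    rw [pullForm_expOp_self hM hs] at h
    rw [le_div_iff₀ hsq]
    refine le_of_sq_le_sq ?_ (hen0 v)
    rw [mul_pow, Real.sq_sqrt hα.le, mul_comm]
    exact h
  set f : List (Fin n) → ℝ := fun L =>
    (L.countP (p ·)).factorial / Real.log 2 ^ L.countP (p ·) with hf
  have hf0 : ∀ L, 0 ≤ f L := fun L => by positivity
  set c : List (Fin n) → ℝ := fun L =>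
    ((L.filter (p ·)).map b).prod * (‖σ (L.filter (¬ p ·)) y‖ / √α) with hc
  have hc0 : ∀ L, 0 ≤ c L := fun L => mul_nonneg (hprod _) (by positivity)
  have main : ∀ L : List (Fin n), en (listDeriv L u y) ≤ f L * c L := by
    intro L
    induction hlen : L.length using Nat.strong_induction_on generalizing L with
    | _ m ih =>
    subst hlen
    set v := listDeriv L u y with hv
    have hrec := congrArg (fun T => T v) (splitSum_pullForm_listDeriv hM G hu hσ heq L y)
    rw [splitSum_eq_add] at hrec
    simp only [add_apply] at hrec
    rw [show prodOp M [] * expOp M y = expOp M y from one_mul _, ← hv,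
      pullForm_expOp_self hM hs] at hrec
    -- The right-hand side contributes only if no direction has property `p`.
    have hrhs : ‖σ L y‖ / √α ≤ if L.countP (p ·) = 0 then c L else 0 := by
      split_ifs with h0
      · have hnp : ∀ i ∈ L, ¬ p i := by simpa [List.countP_eq_zero] using h0
        have h1 : L.filter (p ·) = [] := by simpa [List.filter_eq_nil_iff] using hnp
        have h2 : L.filter (¬ p ·) = L := by simpa [List.filter_eq_self] using hnp
        simp only [hc]
        rw [h1, h2]
        simp
      · obtain ⟨i, hi, hpi⟩ : ∃ i ∈ L, p i := by
          by_contra! hcon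
          exact h0 (by simpa [List.countP_eq_zero] using hcon)
        rw [hσ0 L i y hi hpi]; simp
    -- The lower-order terms: bounded by the induction hypothesis.
    have hlow : |splitSum L (fun P Q => if P = [] then 0 else
          pullForm G (prodOp M P * expOp M y) (listDeriv Q u y)) v|
        ≤ (if L.countP (p ·) = 0 then 0 else f L) * (c L * en v) := by
      have h1 := map_splitSum
        (ContinuousLinearMap.apply ℝ ℝ v : StrongDual ℝ W →L[ℝ] ℝ).toLinearMap.toAddMonoidHom L
        (fun P Q => if P = [] then 0 else
          pullForm G (prodOp M P * expOp M y) (listDeriv Q u y))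
      have h1' : splitSum L (fun P Q => if P = [] then 0 else
          pullForm G (prodOp M P * expOp M y) (listDeriv Q u y)) v = _ := h1
      rw [h1', ← Real.norm_eq_abs]
      refine (norm_splitSum_le _ _).trans ?_
      refine le_trans ?_ (mul_le_mul_of_nonneg_right (splitSum_factorial_div_log_two_le p L)
        (mul_nonneg (hc0 L) (hen0 v)))
      rw [← splitSum_mul_right]
      refine splitSum_le_splitSum _ _ _ fun P Q hPQ => ?_
      by_cases hP : P = []
      · simp [hP]
      · simp only [hP, if_false]
        change |pullForm G (prodOp M P * expOp M y) (listDeriv Q u y) v| ≤ _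
        refine (abs_pullForm_prodOp_mul_expOp_le hM hs G P y _ _).trans ?_
        -- A direction without property `p` in `P` makes the product of the operators vanish.
        split_ifs with hPp
        · have hlt : Q.length < L.length := by
            have := hPQ.length_eq
            have := List.length_pos_of_ne_nil hP
            simp only [List.length_append] at *
            omega
          have hPf : P.filter (p ·) = P := by simpa [List.filter_eq_self] using hPp
          have hPn : P.filter (¬ p ·) = [] := by simpa [List.filter_eq_nil_iff] using hPp
          have hb1 : (P.map b).prod * ((Q.filter (p ·)).map b).prod
              = ((L.filter (p ·)).map b).prod := by
            have := ((hPQ.filter (p ·)).map b).prod_eq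
            rwa [List.filter_append, hPf, List.map_append, List.prod_append] at this
          have hs1 : σ (Q.filter (¬ p ·)) y = σ (L.filter (¬ p ·)) y := by
            refine hperm _ _ y ?_
            have := hPQ.filter (¬ p ·)
            rwa [List.filter_append, hPn, List.nil_append] at this
          have hcPQ : (P.map b).prod * c Q = c L := by
            simp only [hc]
            rw [← mul_assoc, hb1, hs1]
          calc ‖prodOp M P‖ * en (listDeriv Q u y) * en v
              ≤ (P.map b).prod * (f Q * c Q) * en v := by
                refine mul_le_mul_of_nonneg_right ?_ (hen0 v)
                exact mul_le_mul (norm_prodOp_le hb P) (ih _ hlt Q rfl) (hen0 _) (hprod P)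
            _ = f Q * (c L * en v) := by rw [← hcPQ]; ring
        · push Not at hPp
          obtain ⟨i, hi, hpi⟩ := hPp
          rw [prodOp_eq_zero hi (hM0 i hpi)]
          simp
    have hσv : σ L y v ≤ (‖σ L y‖ / √α) * en v := by
      calc σ L y v ≤ ‖σ L y‖ * ‖v‖ := (le_abs_self _).trans ((σ L y).le_opNorm v)
        _ ≤ ‖σ L y‖ * (en v / √α) := by gcongr; exact hVen v
        _ = _ := by ring
    have hfin : en v ^ 2 ≤ (f L * c L) * en v := by
      have h1 : en v ^ 2 ≤ (‖σ L y‖ / √α) * en v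
          + (if L.countP (p ·) = 0 then 0 else f L) * (c L * en v) := by
        have := (abs_le.mp hlow).1
        have h2 : en v ^ 2 = ‖expOp M ((2⁻¹ : ℝ) • y) (G v)‖ ^ 2 := rfl
        linarith
      have h2 := mul_le_mul_of_nonneg_right hrhs (hen0 v)
      -- Exactly one of the two terms is present; in the first case `f L = 0! / (ln 2)⁰ = 1`.
      split_ifs at h1 h2 with h0
      · have : f L = 1 := by simp only [hf]; rw [h0]; simp
        rw [this]; linarith
      · linarith
    rcases (hen0 v).eq_or_lt with h0 | h0
    · rw [← h0]; exact mul_nonneg (hf0 L) (hc0 L)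
    · rw [sq] at hfin
      exact le_of_mul_le_mul_right hfin h0
  calc ‖listDeriv L u y‖ ≤ en (listDeriv L u y) / √α := hVen _
    _ ≤ f L * c L / √α := by gcongr; exact main L
    _ = _ := by
      simp only [hf, hc]
      rw [mul_div_assoc, mul_div_assoc, div_div, Real.mul_self_sqrt hα.le, ← mul_assoc]

end Abstract

/-! ### Multiplication operators -/

section Multiplication

-- Instances on nested spaces of operators are not found at the default depth.
set_option maxSynthPendingDepth 3

variable {X F : Type} [MeasurableSpace X] {μ : Measure X} [NormedAddCommGroup F]
  [InnerProductSpace ℝ F]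

variable (μ F) in
/-- The operator on `L²(μ; F)` of multiplication with a function in `L^∞(μ)`. -/
def mulOp : Lp ℝ ∞ μ →L[ℝ] (Lp F 2 μ →L[ℝ] Lp F 2 μ) :=
  (ContinuousLinearMap.lsmul ℝ ℝ : ℝ →L[ℝ] F →L[ℝ] F).holderL μ ∞ 2 2

theorem coeFn_mulOp (g : Lp ℝ ∞ μ) (f : Lp F 2 μ) :
    mulOp F μ g f =ᵐ[μ] fun x => g x • f x :=
  ContinuousLinearMap.coeFn_holder _ g f

theorem norm_mulOp_le (g : Lp ℝ ∞ μ) : ‖mulOp F μ g‖ ≤ ‖g‖ := by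
  refine ContinuousLinearMap.opNorm_le_bound _ (norm_nonneg _) fun f => ?_
  refine (ContinuousLinearMap.norm_holder_apply_apply_le _ g f).trans ?_
  gcongr
  exact mul_le_of_le_one_left (norm_nonneg _) ContinuousLinearMap.opNorm_lsmul_le

theorem commute_mulOp (g h : Lp ℝ ∞ μ) : Commute (mulOp F μ g) (mulOp F μ h) := by
  refine ContinuousLinearMap.ext fun f => Lp.ext ?_
  change mulOp F μ g (mulOp F μ h f) =ᵐ[μ] mulOp F μ h (mulOp F μ g f)
  filter_upwards [coeFn_mulOp g (mulOp F μ h f), coeFn_mulOp h f, coeFn_mulOp h (mulOp F μ g f),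
    coeFn_mulOp g f] with x h1 h2 h3 h4
  rw [h1, h2, h3, h4, smul_comm]

theorem isSelfAdjoint_mulOp [CompleteSpace F] (g : Lp ℝ ∞ μ) : IsSelfAdjoint (mulOp F μ g) := by
  rw [ContinuousLinearMap.isSelfAdjoint_iff_isSymmetric]
  intro f h
  simp only [ContinuousLinearMap.coe_coe, L2.inner_def]
  refine integral_congr_ae ?_
  filter_upwards [coeFn_mulOp g f, coeFn_mulOp g h] with x h1 h2
  rw [h1, h2, real_inner_smul_left, real_inner_smul_right]

/-- The exponential series converges in `L²`, so its partial sums converge almost everywhere along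
a subsequence, and the limit is the pointwise exponential. -/
theorem coeFn_exp_mulOp [CompleteSpace F] (g : Lp ℝ ∞ μ) (f : Lp F 2 μ) :
    NormedSpace.exp (mulOp F μ g) f =ᵐ[μ] fun x => Real.exp (g x) • f x := by
  have hpow : ∀ k : ℕ, ((mulOp F μ g) ^ k) f =ᵐ[μ] fun x => g x ^ k • f x := by
    intro k
    induction k with
    | zero => simp
    | succ k ih =>
      rw [pow_succ']
      filter_upwards [ih, coeFn_mulOp g ((mulOp F μ g ^ k) f)] with x h1 h2
      rw [mul_apply_eq_comp, h2, h1, smul_smul, pow_succ']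
  have hsum := (NormedSpace.exp_series_hasSum_exp' (𝕂 := ℝ) (mulOp F μ g)).mapL
    (ContinuousLinearMap.apply ℝ (Lp F 2 μ) f)
  have hpart : ∀ N : ℕ, (∑ k ∈ Finset.range N, ContinuousLinearMap.apply ℝ (Lp F 2 μ) f
        (((k.factorial : ℝ)⁻¹) • mulOp F μ g ^ k) : Lp F 2 μ)
      =ᵐ[μ] fun x => (∑ k ∈ Finset.range N, (k.factorial : ℝ)⁻¹ • g x ^ k) • f x := by
    intro N
    induction N with
    | zero =>
      filter_upwards [Lp.coeFn_zero F 2 μ] with x hx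
      simpa using hx
    | succ N ih =>
      rw [Finset.sum_range_succ]
      refine (Lp.coeFn_add _ _).trans ?_
      have h1 := Lp.coeFn_smul ((N.factorial : ℝ)⁻¹) ((mulOp F μ g ^ N) f)
      filter_upwards [ih, hpow N, h1] with x h1 h2 h3
      rw [Pi.add_apply, h1, Finset.sum_range_succ, add_smul, smul_assoc (_ : ℝ) (g x ^ N) (f x),
        ← h2]
      exact congrArg _ h3
  obtain ⟨ns, hns, hae⟩ :=
    (tendstoInMeasure_of_tendsto_Lp hsum.tendsto_sum_nat).exists_seq_tendsto_ae
  filter_upwards [hae, ae_all_iff.mpr hpart] with x hx hp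
  simp only [hp] at hx
  refine tendsto_nhds_unique hx ?_
  have h1 := (NormedSpace.exp_series_hasSum_exp' (𝕂 := ℝ) (g x)).tendsto_sum_nat.comp
    hns.tendsto_atTop
  rw [← Real.exp_eq_exp_ℝ] at h1
  exact h1.smul_const (f x)

end Multiplication

/-! ### The Hilbert space `V` -/

section HilbertV

variable {d : ℕ} {D : Domain d}

/-- By the Friedrichs inequality the norm of `V` is equivalent to that of `H¹(D)`, in which `V` is
closed. -/
instance (D : Domain d) : CompleteSpace (V D) := by
  obtain ⟨C, hC⟩ := V.friedrichs D
  have hcl : IsClosed (sobolevH10 D.carrier : Set (L2 D.carrier × L2Vec D.carrier)) :=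
    Submodule.isClosed_topologicalClosure _
  have : CompleteSpace (sobolevH10 D.carrier) := hcl.completeSpace_coe
  let e : sobolevH10 D.carrier ≃ₗ[ℝ] V D := LinearEquiv.refl ℝ (sobolevH10 D.carrier)
  let e' : sobolevH10 D.carrier ≃L[ℝ] V D := e.toContinuousLinearEquivOfBounds 1 (max C 1)
    (fun v => by
      rw [one_mul]
      exact norm_snd_le (v : L2 D.carrier × L2Vec D.carrier))
    (fun v => by
      refine max_le ((hC v).trans ?_) ?_
      · exact mul_le_mul_of_nonneg_right (le_max_left _ _) (norm_nonneg (V.grad v))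
      · exact le_mul_of_one_le_left (norm_nonneg (V.grad v)) (le_max_right _ _))
  exact (completeSpace_congr (e := e'.toEquiv) e'.isUniformEmbedding).mp this

/-- The inner product `∫_D ∇u · ∇v` induces the norm of `V`. -/
instance (D : Domain d) : InnerProductSpace ℝ (V D) where
  inner u v := ⟪V.grad u, V.grad v⟫_ℝ
  norm_sq_eq_re_inner u := (real_inner_self_eq_norm_sq (V.grad u)).symm
  conj_inner_symm u v := by simp [real_inner_comm]
  add_left u v w := by simp [inner_add_left]
  smul_left u v c := by simp [real_inner_smul_left]

variable (D) in
/-- The gradient as a bounded operator `V → L²(D; ℝᵈ)`. -/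
def gradL : V D →L[ℝ] L2Vec D.carrier :=
  V.grad.mkContinuous 1 fun v => (one_mul ‖v‖).symm ▸ le_rfl

theorem gradL_apply (v : V D) : gradL D v = V.grad v := rfl

end HilbertV

/-! ### The coefficient -/

section Coefficient

variable {d s : ℕ} {D : Domain d} {a : Fin s → Space d → ℝ}

theorem vol_ne_zero (D : Domain d) : vol D.carrier ≠ 0 := by
  rw [Ne, Measure.restrict_eq_zero]
  exact (D.carrier.isOpen.measure_pos volume D.nonempty).ne'

/-- The functions that multiply the parameters in the exponent of the coefficient: `0` for the
parameters `wᵢ` and `aⱼ` for the parameters `zⱼ`. -/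
def exponent (ha : ∀ j, MemLp (a j) ∞ (vol D.carrier)) :
    Fin (s + 1 + s) → Lp ℝ ∞ (vol D.carrier) :=
  Fin.addCases (fun _ => 0) fun j => (ha j).toLp (a j)

theorem coeFn_sum_exponent (ha : ∀ j, MemLp (a j) ∞ (vol D.carrier))
    (y : Fin (s + 1 + s) → ℝ) :
    (∑ i, y i • exponent ha i : Lp ℝ ∞ (vol D.carrier)) =ᵐ[vol D.carrier]
      fun x => ∑ j, zPart y j * a j x := by
  have h : ∑ i, y i • exponent ha i = ∑ j, zPart y j • (ha j).toLp (a j) := by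
    simp [Fin.sum_univ_add, exponent, zPart]
  rw [h]
  have hj : ∀ j, ((zPart y j • (ha j).toLp (a j) : Lp ℝ ∞ (vol D.carrier)) : Space d → ℝ)
      =ᵐ[vol D.carrier] fun x => zPart y j * a j x := fun j => by
    filter_upwards [Lp.coeFn_smul (zPart y j) ((ha j).toLp (a j)), (ha j).coeFn_toLp]
      with x h1 h2
    rw [h1, Pi.smul_apply, h2, smul_eq_mul]
  filter_upwards [Lp.coeFn_finsetSum Finset.univ fun j => zPart y j • (ha j).toLp (a j),
    ae_all_iff.mpr hj] with x h1 h2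
  rw [h1]
  simp [h2]

/-- The operators whose exponential is the multiplication with the coefficient. -/
def exponentOp (ha : ∀ j, MemLp (a j) ∞ (vol D.carrier)) (i : Fin (s + 1 + s)) :
    L2Vec D.carrier →L[ℝ] L2Vec D.carrier :=
  mulOp (Space d) (vol D.carrier) (exponent ha i)

theorem coeFn_expOp_exponentOp (ha : ∀ j, MemLp (a j) ∞ (vol D.carrier))
    (y : Fin (s + 1 + s) → ℝ) (f : L2Vec D.carrier) :
    expOp (exponentOp ha) y f =ᵐ[vol D.carrier] fun x => coeff a (zPart y) x • f x := by
  have h : ∑ i, y i • exponentOp ha i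
      = mulOp (Space d) (vol D.carrier) (∑ i, y i • exponent ha i) := by
    simp only [exponentOp, map_sum, map_smul]
  rw [expOp, h]
  filter_upwards [coeFn_exp_mulOp (∑ i, y i • exponent ha i) f, coeFn_sum_exponent ha y]
    with x h1 h2
  rw [h1, h2, coeff]

theorem bilin_eq_pullForm (ha : ∀ j, MemLp (a j) ∞ (vol D.carrier))
    (y : Fin (s + 1 + s) → ℝ) (u v : V D) :
    bilin a (zPart y) u v = pullForm (gradL D) (expOp (exponentOp ha) y) u v := by
  rw [pullForm_apply, L2.inner_def]
  refine integral_congr_ae ?_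
  filter_upwards [coeFn_expOp_exponentOp ha y (gradL D u)] with x hx
  rw [hx, real_inner_smul_left, gradL_apply, gradL_apply]

theorem exists_abs_sum_le (ha : ∀ j, MemLp (a j) ∞ (vol D.carrier)) (z : Fin s → ℝ) :
    ∃ C : ℝ, ∀ᵐ x ∂(vol D.carrier), |∑ j, z j * a j x| ≤ C := by
  have hm : MemLp (fun x => ∑ j, z j * a j x) ∞ (vol D.carrier) :=
    memLp_finsetSum _ fun j _ => (ha j).const_mul (z j)
  refine ⟨(eLpNormEssSup (fun x => ∑ j, z j * a j x) (vol D.carrier)).toReal, ?_⟩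
  have hfin := hm.2
  rw [eLpNorm_exponent_top] at hfin
  filter_upwards [ae_le_eLpNormEssSup (f := fun x => ∑ j, z j * a j x) (μ := vol D.carrier)]
    with x hx
  simpa using ENNReal.toReal_mono hfin.ne hx

theorem isBoundedUnder_ge_coeff (D : Domain d) (a : Fin s → Space d → ℝ) (z : Fin s → ℝ) :
    Filter.IsBoundedUnder (· ≥ ·) (ae (vol D.carrier)) (coeff a z) :=
  ⟨0, Filter.eventually_map.mpr (Filter.Eventually.of_forall fun _ => (Real.exp_pos _).le)⟩

theorem aMin_pos (ha : ∀ j, MemLp (a j) ∞ (vol D.carrier)) (z : Fin s → ℝ) : 0 < aMin D a z := by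
  obtain ⟨C, hC⟩ := exists_abs_sum_le ha z
  have : (ae (vol D.carrier)).NeBot := ae_neBot.mpr (vol_ne_zero D)
  refine (Real.exp_pos (-C)).trans_le (Filter.le_liminf_of_le ?_ ?_)
  · refine Filter.IsBoundedUnder.isCoboundedUnder_ge ⟨Real.exp C, Filter.eventually_map.mpr ?_⟩
    filter_upwards [hC] with x hx
    exact Real.exp_le_exp.mpr (abs_le.mp hx).2
  · filter_upwards [hC] with x hx
    exact Real.exp_le_exp.mpr (abs_le.mp hx).1

theorem aMin_mul_norm_sq_le (ha : ∀ j, MemLp (a j) ∞ (vol D.carrier))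
    (y : Fin (s + 1 + s) → ℝ) (v : V D) :
    aMin D a (zPart y) * ‖v‖ ^ 2 ≤ pullForm (gradL D) (expOp (exponentOp ha) y) v v := by
  have hint := L2.integrable_inner (𝕜 := ℝ) (expOp (exponentOp ha) y (gradL D v)) (gradL D v)
  rw [pullForm_apply, L2.inner_def, show ‖v‖ = ‖gradL D v‖ from rfl, norm_sq_L2,
    ← integral_const_mul]
  have hint2 : Integrable (fun x => ‖gradL D v x‖ ^ 2) (vol D.carrier) := by
    simpa only [real_inner_self_eq_norm_sq] using
      L2.integrable_inner (𝕜 := ℝ) (gradL D v) (gradL D v)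
  refine integral_mono_ae (hint2.const_mul _) hint ?_
  filter_upwards [coeFn_expOp_exponentOp ha y (gradL D v),
    ae_essInf_le (isBoundedUnder_ge_coeff D a (zPart y))] with x h1 h2
  simp only [h1, real_inner_smul_left, real_inner_self_eq_norm_sq]
  exact mul_le_mul_of_nonneg_right h2 (sq_nonneg _)

theorem norm_exponentOp_le (ha : ∀ j, MemLp (a j) ∞ (vol D.carrier)) (i : Fin (s + 1 + s)) :
    ‖exponentOp ha i‖ ≤ Fin.addCases (fun _ => 0) (fun j => normLInfty D (a j)) i := by
  refine (norm_mulOp_le _).trans ?_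
  induction i using Fin.addCases with
  | left i => simp [exponent]
  | right j => simp [exponent, normLInfty, Lp.norm_toLp]

end Coefficient

/-! ### The right-hand side and its derivatives -/

section Source

variable {d s : ℕ} {D : Domain d}

/-- The derivatives of the source `ℓ(·, w)`, which is affine in the parameters, in the directions
of a list. -/
def sourceDeriv (lbar : StrongDual ℝ (V D)) (l : Fin (s + 1) → StrongDual ℝ (V D)) :
    List (Fin (s + 1 + s)) → (Fin (s + 1 + s) → ℝ) → StrongDual ℝ (V D)
  | [], y => source lbar l (wPart y)
  | [i], _ => Fin.addCases l (fun _ => 0) i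
  | _ :: _ :: _, _ => 0

variable (lbar : StrongDual ℝ (V D)) (l : Fin (s + 1) → StrongDual ℝ (V D))

theorem sourceDeriv_of_two_le {L : List (Fin (s + 1 + s))} (hL : 2 ≤ L.length)
    (y : Fin (s + 1 + s) → ℝ) : sourceDeriv lbar l L y = 0 := by
  match L, hL with
  | _ :: _ :: _, _ => rfl

theorem hasDerivAt_sourceDeriv (L : List (Fin (s + 1 + s))) (i : Fin (s + 1 + s))
    (y : Fin (s + 1 + s) → ℝ) :
    HasDerivAt (fun t : ℝ => sourceDeriv lbar l L (y + t • Pi.single i 1))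
      (sourceDeriv lbar l (i :: L) y) 0 := by
  match L with
  | [] =>
    have h : ∀ t : ℝ, sourceDeriv lbar l [] (y + t • Pi.single i 1)
        = source lbar l (wPart y) + t • (Fin.addCases l (fun _ => 0) i : StrongDual ℝ (V D)) := by
      intro t
      have hs : ∑ k, (t • Pi.single i (1 : ℝ) : Fin (s + 1 + s) → ℝ) (Fin.castAdd s k) • l k
          = t • (Fin.addCases l (fun _ => 0) i : StrongDual ℝ (V D)) := by
        induction i using Fin.addCases with
        | left k =>
          rw [Finset.sum_eq_single k (fun j _ hj => by simp [hj]) (by simp)]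
          simp
        | right j =>
          rw [Fin.addCases_right, smul_zero]
          refine Finset.sum_eq_zero fun k _ => ?_
          have hne : Fin.castAdd s k ≠ Fin.natAdd (s + 1) j := by
            simp only [Ne, Fin.ext_iff, Fin.val_castAdd, Fin.val_natAdd]
            omega
          simp [hne]
      simp only [sourceDeriv, source, wPart, Pi.add_apply, add_smul, Finset.sum_add_distrib]
      rw [hs]
      exact (add_assoc _ _ _).symm
    simp only [h]
    simpa [sourceDeriv] using ((hasDerivAt_id (0 : ℝ)).smul_const
      (Fin.addCases l (fun _ => 0) i : StrongDual ℝ (V D))).const_add (source lbar l (wPart y))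
  | [j] => exact hasDerivAt_const _ _
  | _ :: _ :: _ => exact hasDerivAt_const _ _

theorem sourceDeriv_perm {L L' : List (Fin (s + 1 + s))} (h : L.Perm L')
    (y : Fin (s + 1 + s) → ℝ) : sourceDeriv lbar l L y = sourceDeriv lbar l L' y := by
  match L with
  | [] => rw [h.nil_eq]
  | [i] => rw [List.singleton_perm.mp h]
  | _ :: _ :: _ =>
    rw [sourceDeriv_of_two_le lbar l (L := L') (h.length_eq ▸ by simp)]
    rfl

theorem sourceDeriv_eq_zero {L : List (Fin (s + 1 + s))} {i : Fin (s + 1 + s)} (hi : i ∈ L)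
    (hp : s + 1 ≤ (i : ℕ)) (y : Fin (s + 1 + s) → ℝ) : sourceDeriv lbar l L y = 0 := by
  match L with
  | [j] =>
    obtain rfl := List.mem_singleton.mp hi
    induction i using Fin.addCases with
    | left k => simp only [Fin.val_castAdd] at hp; omega
    | right j => simp [sourceDeriv]
  | _ :: _ :: _ => rfl

theorem norm_source_le (w : Fin (s + 1) → ℝ) :
    ‖source lbar l w‖ ≤ ‖lbar‖ + ∑ i, ‖l i‖ * |w i| := by
  refine (norm_add_le _ _).trans (add_le_add_right ((norm_sum_le _ _).trans ?_) _)
  refine Finset.sum_le_sum fun i _ => ?_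
  rw [norm_smul, Real.norm_eq_abs, mul_comm]

theorem contDiff_source :
    ContDiff ℝ (⊤ : ℕ∞) fun y : Fin (s + 1 + s) → ℝ => source lbar l (wPart y) := by
  unfold source wPart
  fun_prop

end Source

/-! ### The list of directions of a multi-index -/

section MultiIndex

variable {s : ℕ} (ν : Fin (s + 1 + s) → ℕ)

theorem countP_directions_z :
    (directions ν).countP (fun i : Fin (s + 1 + s) => s + 1 ≤ (i : ℕ)) = ∑ j, zPart ν j := by
  rw [directions, List.countP_flatMap, ← List.ofFn_eq_map, List.sum_ofFn, Fin.sum_univ_add]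
  have hw : ∀ i : Fin (s + 1), ¬ s < (i : ℕ) := fun i => by omega
  have hz : ∀ j : Fin s, s < s + 1 + (j : ℕ) := fun j => by omega
  simp [List.countP_replicate, zPart, hw, hz]

theorem length_filter_directions_w :
    ((directions ν).filter (fun i : Fin (s + 1 + s) => ¬ s + 1 ≤ (i : ℕ))).length
      = ∑ i, wPart ν i := by
  rw [← List.countP_eq_length_filter, directions, List.countP_flatMap, ← List.ofFn_eq_map,
    List.sum_ofFn, Fin.sum_univ_add]
  have hw : ∀ i : Fin (s + 1), (i : ℕ) ≤ s := fun i => by omega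
  have hz : ∀ j : Fin s, ¬ s + 1 + (j : ℕ) ≤ s := fun j => by omega
  simp [List.countP_replicate, wPart, hw, hz]

theorem prod_filter_directions_z (b : Fin (s + 1 + s) → ℝ) :
    (((directions ν).filter (fun i : Fin (s + 1 + s) => s + 1 ≤ (i : ℕ))).map b).prod
      = ∏ j, zPart b j ^ zPart ν j := by
  have h : ∀ R : List (Fin (s + 1 + s)),
      (((R.flatMap fun i => List.replicate (ν i) i).filter
        (fun i : Fin (s + 1 + s) => s + 1 ≤ (i : ℕ))).map b).prod
      = (R.map fun i : Fin (s + 1 + s) => if s + 1 ≤ (i : ℕ) then b i ^ ν i else 1).prod := by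
    intro R
    induction R with
    | nil => rfl
    | cons i R ih =>
      rw [List.flatMap_cons, List.filter_append, List.map_append, List.prod_append, ih,
        List.map_cons, List.prod_cons, List.filter_replicate]
      split_ifs <;> simp_all
  rw [directions, h, ← List.ofFn_eq_map, List.prod_ofFn, Fin.prod_univ_add]
  have hw : ∀ i : Fin (s + 1), ¬ s < (i : ℕ) := fun i => by omega
  simp [zPart, hw]

end MultiIndex

end

end LognormalPDE

theorem theorem3p1 {d s : ℕ} (D : Domain d)
    (a : Fin s → Space d → ℝ) (ha : ∀ j, MemW1Infty D.carrier (a j))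
    (lbar : StrongDual ℝ (V D)) (l : Fin (s + 1) → StrongDual ℝ (V D))
    (hl0 : IsPositiveBounded (l 0)) :
    (∀ y : Fin (s + 1 + s) → ℝ, ∃! v : V D, IsSolution a lbar l y v) ∧
    ∀ u : (Fin (s + 1 + s) → ℝ) → V D, (∀ y, IsSolution a lbar l y (u y)) →
      ContDiff ℝ (⊤ : ℕ∞) u ∧
      ∀ (ν : Fin (s + 1 + s) → ℕ) (y : Fin (s + 1 + s) → ℝ),
        (wPart ν = 0 →
          ‖mixedDeriv ν u y‖ ≤
            (Nat.factorial (∑ j, zPart ν j) : ℝ) / Real.log 2 ^ (∑ j, zPart ν j) *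
              (∏ j, normLInfty D (a j) ^ zPart ν j) *
              ((‖lbar‖ + ∑ i, ‖l i‖ * |wPart y i|) / aMin D a (zPart y))) ∧
        (∀ k : Fin (s + 1), wPart ν = Pi.single k 1 →
          ‖mixedDeriv ν u y‖ ≤
            (Nat.factorial (∑ j, zPart ν j) : ℝ) / Real.log 2 ^ (∑ j, zPart ν j) *
              (∏ j, normLInfty D (a j) ^ zPart ν j) *
              (‖l k‖ / aMin D a (zPart y))) ∧
        (2 ≤ ∑ i, wPart ν i → mixedDeriv ν u y = 0) := by
  have ha' : ∀ j, MemLp (a j) ∞ (vol D.carrier) := fun j => (ha j).1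
  have hsol : ∀ y v, IsSolution a lbar l y v ↔
      pullForm (gradL D) (expOp (exponentOp ha') y) v = sourceDeriv lbar l [] y := fun y v => by
    rw [ContinuousLinearMap.ext_iff]
    exact forall_congr' fun v' => by rw [bilin_eq_pullForm ha']; rfl
  have hequiv : ∀ y, ∃ e : V D ≃L[ℝ] StrongDual ℝ (V D),
      (e : V D →L[ℝ] StrongDual ℝ (V D)) = pullForm (gradL D) (expOp (exponentOp ha') y) :=
    fun y => exists_equiv_of_coercive (aMin_pos ha' (zPart y)) (aMin_mul_norm_sq_le ha' y)
  refine ⟨fun y => ?_, fun u hu => ?_⟩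
  · obtain ⟨e, he⟩ := hequiv y
    simp only [hsol, ← he]
    exact e.bijective.existsUnique _
  have heq := fun y => (hsol y (u y)).mp (hu y)
  have hsmooth : ContDiff ℝ (⊤ : ℕ∞) u :=
    contDiff_of_equiv (ContDiff.comp (by fun_prop) (contDiff_expOp (exponentOp ha')))
      (contDiff_source lbar l) hequiv heq
  refine ⟨hsmooth, fun ν y => ?_⟩
  have hbound := norm_listDeriv_le (fun i : Fin (s + 1 + s) => s + 1 ≤ (i : ℕ))
    (M := exponentOp ha') (fun i j => commute_mulOp _ _) (fun i => isSelfAdjoint_mulOp _)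
    (norm_exponentOp_le ha')
    (fun i hi => by
      induction i using Fin.addCases with
      | left k => simp [exponentOp, exponent]
      | right j => simp at hi)
    (gradL D) hsmooth (hasDerivAt_sourceDeriv lbar l) heq
    (fun L L' y h => sourceDeriv_perm lbar l h y)
    (fun L i y hi hp => sourceDeriv_eq_zero lbar l hi hp y) y (aMin_pos ha' (zPart y))
    (aMin_mul_norm_sq_le ha' y) (directions ν)
  rw [← mixedDeriv_eq_listDeriv, countP_directions_z, prod_filter_directions_z] at hbound
  simp only [zPart, Fin.addCases_right] at hbound
  have hlog : 0 < Real.log 2 := Real.log_pos (by norm_num)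
  have hfac : 0 ≤ (Nat.factorial (∑ j, zPart ν j) : ℝ) / Real.log 2 ^ (∑ j, zPart ν j) *
      (∏ j, normLInfty D (a j) ^ zPart ν j) :=
    mul_nonneg (by positivity)
      (Finset.prod_nonneg fun j _ => pow_nonneg ENNReal.toReal_nonneg _)
  have hlen := length_filter_directions_w ν
  refine ⟨fun hν => ?_, fun k hν => ?_, fun hν => ?_⟩
  · have hnil : (directions ν).filter (fun i : Fin (s + 1 + s) => ¬ s + 1 ≤ (i : ℕ)) = [] :=
      List.length_eq_zero_iff.mp (by rw [hlen, hν]; simp)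
    rw [hnil] at hbound
    refine hbound.trans (mul_le_mul_of_nonneg_left ?_ hfac)
    exact div_le_div_of_nonneg_right (norm_source_le lbar l _) (aMin_pos ha' _).le
  · have hone : (directions ν).filter (fun i : Fin (s + 1 + s) => ¬ s + 1 ≤ (i : ℕ)) =
        [Fin.castAdd s k] := by
      obtain ⟨i, hi⟩ := List.length_eq_one_iff.mp (hlen.trans (by rw [hν]; simp))
      have hk : Fin.castAdd s k ∈
          (directions ν).filter (fun i : Fin (s + 1 + s) => ¬ s + 1 ≤ (i : ℕ)) := by
        rw [List.mem_filter, ← List.count_pos_iff, count_directions]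
        have h1 : ν (Fin.castAdd s k) = 1 := by simpa [wPart] using congrFun hν k
        exact ⟨by rw [h1]; exact one_pos, by simp; omega⟩
      rw [hi] at hk ⊢
      rw [List.mem_singleton.mp hk]
    rw [hone] at hbound
    simpa [sourceDeriv, zPart] using hbound
  · rw [sourceDeriv_of_two_le lbar l (hν.trans_eq hlen.symm)] at hbound
    simpa using hbound
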